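/- **Theorem 3.** Consider the disturbed linear system $$\dot x = A x + B u + B_d d,\qquad z = C_z x + D_z u,\qquad y = Cx,$$ with state $x$, control $u$, disturbance $d$ (of dimension at least one), performance output $z$ and measured output $y$, where $A_{\mathcal N}, B, B_d, C, C_z, D_z, L, R$ are given real matrices of compatible sizes ($L,R$ square) and the system matrix is uncertain, $A = A_{\mathcal N} + LFR$ with an unknown constant real square matrix $F$ satisfying $F^TF \preceq I$. (The linearized mixed-traffic systems with one automated vehicle on a ring road or an open road are special cases.) Suppose that real numbers $\eta,\epsilon_1,\epsilon_2,\epsilon_3$ and real matrices $X,Y,\hat A,\hat B,\hat C$ satisfy $$\begin{bmatrix} X & I\\ I & Y\end{bmatrix}\succ 0,\qquad \begin{bmatrix}\Gamma_{11} & \Gamma_{12}\\ \Gamma_{12}^T & \Gamma_{22}\end{bmatrix}\prec 0,$$ where $$\Gamma_{11}=\begin{bmatrix} A_{\mathcal N}X+XA_{\mathcal N}^T+B\hat C+\hat C^TB^T+(\epsilon_1+\epsilon_2)LL^T & \hat A^T+A_{\mathcal N} & B_d & XC_z^T+\hat C^TD_z^T\\ * & A_{\mathcal N}^TY+YA_{\mathcal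 N}+\hat BC+C^T\hat B^T+\epsilon_3R^TR & YB_d & C_z^T\\ * & * & -\eta I & 0\\ * & * & * & -I\end{bmatrix},$$ $$\Gamma_{12}=\begin{bmatrix} XR^T&0&0&0&XR^T\\ 0&R^T&YL&YL&0\\ 0&0&0&0&0\\ 0&0&0&0&0\end{bmatrix},\qquad \Gamma_{22}=-\mathrm{diag}(\epsilon_1I,\epsilon_2I,\epsilon_3I,I,I).$$ Then there are nonsingular matrices $M,N$ with $NM^T=I-YX$. Moreover, for every such pair $M,N$, the controller $$\dot x_k=A_kx_k+B_ky,\qquad u=C_kx_k,$$ $$B_k=N^{-1}\hat B,\quad C_k=\hat CM^{-T},\quad A_k=N^{-1}\bigl(\hat A-NB_kCX-YBC_kM^T-YA_{\mathcal N}X\bigr)M^{-T}$$ (which does not depend on $F$) has the following properties for every $F$ with $F^TF\preceq I$. The closed loop $$\dot{\bar x}=\bar A\bar x+\bar Bd,\quad z=\bar C\bar x,\qquad \bar A=\begin{bmatrix}A_{\mathcal N}+LFR & BC_k\\ B_kC & A_k\end{bmatrix},\quad \bar B=\begin{bmatrix}B_d\\0\end{bmatrix},\quad \bar C=\begin{bmatrix}C_z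 & D_zC_k\end{bmatrix}$$ is stable (all eigenvalues of $\bar A$ have negative real part), and, with $\gamma=\sqrt\eta$, its transfer function $T_{zd}(s)=\bar C(sI-\bar A)^{-1}\bar B$ from $d$ to $z$ satisfies $\|T_{zd}\|_\infty<\gamma$. The latter bound holds both for the induced $L^2$ gain $\sup_{0\ne d\in L^2[0,\infty)}\|z\|_2/\|d\|_2$ from zero initial state and for $\sup_{\omega\in\mathbb R}\|T_{zd}(i\omega)\|$ (largest singular value). -/

import Mathlib

open Matrix MeasureTheory
open scoped ENNReal Matrix.Norms.L2Operator

noncomputable section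

/-- Data of the disturbed uncertain linear system
`x' = (A_N + L F R) x + B u + B_d d`, `z = C_z x + D_z u`, `y = C x`.
The index types are those of the state (`σ`), the control input (`ι`), the disturbance (`δ`),
the measured output (`κ`) and the performance output (`ζ`). -/
structure UncertainPlant (σ ι δ κ ζ : Type*) where
  AN : Matrix σ σ ℝ
  B : Matrix σ ι ℝ
  Bd : Matrix σ δ ℝ
  C : Matrix κ σ ℝ
  Cz : Matrix ζ σ ℝ
  Dz : Matrix ζ ι ℝ
  L : Matrix σ σ ℝ
  R : Matrix σ σ ℝ

/-- Data of the dynamic output-feedback controller `x_k' = A_k x_k + B_k y`, `u = C_k x_k`,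
whose state has the dimension of the plant state. -/
structure OutputController (σ ι κ : Type*) where
  Ak : Matrix σ σ ℝ
  Bk : Matrix σ κ ℝ
  Ck : Matrix ι σ ℝ

/-- A real symmetric matrix is negative definite, `M ≺ 0`. -/
def Matrix.NegDef {α : Type*} (M : Matrix α α ℝ) : Prop := (-M).PosDef

/-- All complex eigenvalues of the real matrix `M` lie in the open left half-plane. -/
def Matrix.IsHurwitz {α : Type*} [Fintype α] [DecidableEq α] (M : Matrix α α ℝ) : Prop :=
  ∀ μ ∈ spectrum ℂ (M.map (Complex.ofReal : ℝ → ℂ)), μ.re < 0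

/-! ### Input-output gain of a linear system `x' = A x + B d`, `z = C x` -/

section Gain

variable {α δ ζ : Type*} [Fintype α] [Fintype δ] [Fintype ζ]

/-- `z` is the output, on the time axis `[0, ∞)`, of `x' = A x + B d`, `z = C x` started
at `x 0 = 0`, where the differential equation is understood in integrated
(Caratheodory) form. -/
def IsZeroStateResponse (A : Matrix α α ℝ) (B : Matrix α δ ℝ) (C : Matrix ζ α ℝ)
    (d : ℝ → EuclideanSpace ℝ δ) (z : ℝ → EuclideanSpace ℝ ζ) : Prop :=
  ∃ x : ℝ → (α → ℝ), ContinuousOn x (Set.Ici 0) ∧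
    (∀ t, 0 ≤ t → x t = ∫ s in (0 : ℝ)..t, (A *ᵥ x s + B *ᵥ (d s).ofLp)) ∧
    ∀ t, 0 ≤ t → z t = WithLp.toLp 2 (C *ᵥ x t)

/-- The induced `L²` gain `sup_{d ≠ 0} ‖z‖₂ / ‖d‖₂` over the square-integrable inputs on
`[0, ∞)`, as an extended nonnegative real. -/
def l2Gain (A : Matrix α α ℝ) (B : Matrix α δ ℝ) (C : Matrix ζ α ℝ) : ℝ≥0∞ :=
  ⨆ (d : ℝ → EuclideanSpace ℝ δ) (z : ℝ → EuclideanSpace ℝ ζ)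
    (_ : MemLp d 2 (volume.restrict (Set.Ici 0)))
    (_ : eLpNorm d 2 (volume.restrict (Set.Ici 0)) ≠ 0)
    (_ : IsZeroStateResponse A B C d z),
    eLpNorm z 2 (volume.restrict (Set.Ici 0)) / eLpNorm d 2 (volume.restrict (Set.Ici 0))

/-- The transfer function `T(s) = C (s I - A)⁻¹ B`. -/
def transferFunction [DecidableEq α] (A : Matrix α α ℝ) (B : Matrix α δ ℝ) (C : Matrix ζ α ℝ)
    (s : ℂ) : Matrix ζ δ ℂ :=
  C.map (Complex.ofReal : ℝ → ℂ) *
    (s • (1 : Matrix α α ℂ) - A.map (Complex.ofReal : ℝ → ℂ))⁻¹ *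
    B.map (Complex.ofReal : ℝ → ℂ)

/-- The supremum over the imaginary axis of the largest singular value (the `ℓ²` operator norm)
of the transfer function, i.e. its `H_∞` norm when `A` is Hurwitz. -/
def hInfNorm [DecidableEq α] [DecidableEq δ] (A : Matrix α α ℝ) (B : Matrix α δ ℝ)
    (C : Matrix ζ α ℝ) : ℝ≥0∞ :=
  ⨆ ω : ℝ, ENNReal.ofReal ‖transferFunction A B C (Complex.I * (ω : ℂ))‖

end Gain

namespace UncertainPlant

variable {σ ι δ κ ζ : Type*}

section ClosedLoop

variable [Fintype σ] [Fintype ι] [Fintype κ]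

/-- The system matrix `A = A_N + L F R` for the uncertainty `F`. -/
def A (G : UncertainPlant σ ι δ κ ζ) (F : Matrix σ σ ℝ) : Matrix σ σ ℝ :=
  G.AN + G.L * F * G.R

/-- Closed-loop system matrix, with state `(x, x_k)`. -/
def closedA (G : UncertainPlant σ ι δ κ ζ) (F : Matrix σ σ ℝ) (K : OutputController σ ι κ) :
    Matrix (σ ⊕ σ) (σ ⊕ σ) ℝ :=
  fromBlocks (G.A F) (G.B * K.Ck) (K.Bk * G.C) K.Ak

/-- Closed-loop disturbance matrix. -/
def closedB (G : UncertainPlant σ ι δ κ ζ) : Matrix (σ ⊕ σ) δ ℝ :=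
  fromRows G.Bd 0

/-- Closed-loop performance-output matrix. -/
def closedC (G : UncertainPlant σ ι δ κ ζ) (K : OutputController σ ι κ) :
    Matrix ζ (σ ⊕ σ) ℝ :=
  fromCols G.Cz (G.Dz * K.Ck)

end ClosedLoop

section LMI

variable [Fintype σ] [Fintype ι] [Fintype κ] [DecidableEq σ] [DecidableEq δ] [DecidableEq ζ]

/-- The block `Γ₁₁`, with rows and columns grouped as `(σ, σ), (δ, ζ)`. -/
def Gamma11 (G : UncertainPlant σ ι δ κ ζ) (η ε₁ ε₂ ε₃ : ℝ) (X Y Ah : Matrix σ σ ℝ)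
    (Bh : Matrix σ κ ℝ) (Ch : Matrix ι σ ℝ) :
    Matrix ((σ ⊕ σ) ⊕ (δ ⊕ ζ)) ((σ ⊕ σ) ⊕ (δ ⊕ ζ)) ℝ :=
  let P : Matrix (σ ⊕ σ) (σ ⊕ σ) ℝ :=
    fromBlocks
      (G.AN * X + X * G.ANᵀ + G.B * Ch + Chᵀ * G.Bᵀ + (ε₁ + ε₂) • (G.L * G.Lᵀ))
      (Ahᵀ + G.AN)
      (Ahᵀ + G.AN)ᵀ
      (G.ANᵀ * Y + Y * G.AN + Bh * G.C + G.Cᵀ * Bhᵀ + ε₃ • (G.Rᵀ * G.R))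
  let Q : Matrix (σ ⊕ σ) (δ ⊕ ζ) ℝ :=
    fromBlocks G.Bd (X * G.Czᵀ + Chᵀ * G.Dzᵀ) (Y * G.Bd) G.Czᵀ
  fromBlocks P Q Qᵀ (fromBlocks (-η • (1 : Matrix δ δ ℝ)) 0 0 (-(1 : Matrix ζ ζ ℝ)))

/-- The block `Γ₁₂`. Its first two block rows are
`[X Rᵀ, 0, 0, 0, X Rᵀ]` and `[0, Rᵀ, Y L, Y L, 0]`; the other two vanish. -/
def Gamma12 (G : UncertainPlant σ ι δ κ ζ) (X Y : Matrix σ σ ℝ) :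
    Matrix ((σ ⊕ σ) ⊕ (δ ⊕ ζ)) (σ ⊕ σ ⊕ σ ⊕ σ ⊕ σ) ℝ :=
  fromRows
    (fromRows
      (fromCols (X * G.Rᵀ) (fromCols 0 (fromCols 0 (fromCols 0 (X * G.Rᵀ)))))
      (fromCols 0 (fromCols G.Rᵀ (fromCols (Y * G.L) (fromCols (Y * G.L) 0)))))
    0

/-- The block `Γ₂₂ = - diag (ε₁ I, ε₂ I, ε₃ I, I, I)`. -/
def Gamma22 (σ : Type*) [DecidableEq σ] (ε₁ ε₂ ε₃ : ℝ) :
    Matrix (σ ⊕ σ ⊕ σ ⊕ σ ⊕ σ) (σ ⊕ σ ⊕ σ ⊕ σ ⊕ σ) ℝ :=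
  -diagonal (Sum.elim (fun _ => ε₁) (Sum.elim (fun _ => ε₂) (Sum.elim (fun _ => ε₃)
    (Sum.elim (fun _ => 1) (fun _ => 1)))))

/-- The variables `(η, ε₁, ε₂, ε₃, X, Y, Â, B̂, Ĉ)` satisfy the two linear matrix
inequalities `[X I; I Y] ≻ 0` and `[Γ₁₁ Γ₁₂; Γ₁₂ᵀ Γ₂₂] ≺ 0`. -/
def LMIFeasible (G : UncertainPlant σ ι δ κ ζ) (η ε₁ ε₂ ε₃ : ℝ) (X Y Ah : Matrix σ σ ℝ)
    (Bh : Matrix σ κ ℝ) (Ch : Matrix ι σ ℝ) : Prop :=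
  (fromBlocks X 1 1 Y).PosDef ∧
  (fromBlocks (G.Gamma11 η ε₁ ε₂ ε₃ X Y Ah Bh Ch) (G.Gamma12 X Y) (G.Gamma12 X Y)ᵀ
    (Gamma22 σ ε₁ ε₂ ε₃)).NegDef

/-- The controller recovered from `(X, Y, Â, B̂, Ĉ)` and nonsingular `M`, `N`:
`A_k = N⁻¹ (Â - N B_k C X - Y B C_k Mᵀ - Y A_N X) M⁻ᵀ`, `B_k = N⁻¹ B̂`, `C_k = Ĉ M⁻ᵀ`. -/
def recoveredController (G : UncertainPlant σ ι δ κ ζ) (X Y Ah : Matrix σ σ ℝ)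
    (Bh : Matrix σ κ ℝ) (Ch : Matrix ι σ ℝ) (M N : Matrix σ σ ℝ) : OutputController σ ι κ :=
  let Bk := N⁻¹ * Bh
  let Ck := Ch * (Mᵀ)⁻¹
  { Ak := N⁻¹ * (Ah - N * Bk * G.C * X - Y * G.B * Ck * Mᵀ - Y * G.AN * X) * (Mᵀ)⁻¹
    Bk := Bk
    Ck := Ck }

end LMI

end UncertainPlant

end

/-!
The argument is a bounded real lemma with storage function `V(x) = xᵀ P x`, where `P` is obtained
from the matrix inequalities by a linearizing change of variables.

* With `Φ = [X I; Mᵀ 0]` and `Θ = [I Y; 0 Nᵀ]`, the relation `N Mᵀ = I - Y X` gives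
  `Φᵀ Θ = [X I; I Y] ≻ 0`, so `P = Θ Φ⁻¹` is symmetric positive definite. In the coordinates
  `x = Φ v` the controller parameters enter `xᵀ P (Ā x + B̄ d)` only through `Â`, `B̂`, `Ĉ`, affinely.
* The uncertain part of this expression is `2 (p + q)ᵀ F (r + s)` with `p = Lᵀ v₁`, `q = Lᵀ Y v₂`,
  `r = R X v₁`, `s = R v₂`. The quadratic form of the large matrix inequality, evaluated at the
  disturbance `d`, at the performance output `z`, and at `Fᵀ p, Fᵀ p, F s, q, r` in the five
  auxiliary blocks, is at least `2 xᵀ P (Ā x + B̄ d) + |z|² - η |d|²`, because `|F s| ≤ |s|`,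
  `|Fᵀ p| ≤ |p|` and `2 qᵀ F r ≤ |q|² + |r|²`. No Schur complement is needed
  (`UncertainPlant.LMIFeasible.closed_form_neg`).
* Hence `P` is a strict certificate (`IsBoundedRealCertificate`), and compactness of the unit sphere
  improves `η` to some `η' < η` (`IsBoundedRealCertificate.exists_margin`). With `d = 0` the
  certificate is a Lyapunov inequality, so `Ā` is Hurwitz. Integrating it along a trajectory
  gives `∫ |z|² ≤ η' ∫ |d|²` (`l2Gain_le_of_dissipative`), and along a complex harmonic response the
  storage term cancels, so that `|T(iω) w|² ≤ η' |w|²` (`hInfNorm_le_of_dissipative`).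
-/

/-! ### Dot products and contractions -/

section MatrixForms

variable {α β : Type*} [Fintype α] [Fintype β]

/-- The form of `Matrix.dotProduct_mulVec` that moves a transposed matrix to the left factor. -/
theorem Matrix.dotProduct_transpose_mulVec_eq (A : Matrix β α ℝ) (v : α → ℝ) (w : β → ℝ) :
    v ⬝ᵥ (Aᵀ *ᵥ w) = (A *ᵥ v) ⬝ᵥ w := by
  rw [dotProduct_mulVec, vecMul_transpose]

omit [Fintype α] in
theorem Matrix.IsHermitian.transpose_eq_self {S : Matrix α α ℝ} (hS : S.IsHermitian) : Sᵀ = S :=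
  (conjTranspose_eq_transpose_of_trivial S).symm.trans hS

theorem Matrix.dotProduct_mulVec_left_of_transpose_eq {S : Matrix α α ℝ} (hS : Sᵀ = S)
    (v w : α → ℝ) :
    v ⬝ᵥ (S *ᵥ w) = (S *ᵥ v) ⬝ᵥ w := by
  rw [← Matrix.dotProduct_transpose_mulVec_eq, hS]

theorem two_mul_dotProduct_le (v w : α → ℝ) : 2 * (v ⬝ᵥ w) ≤ v ⬝ᵥ v + w ⬝ᵥ w := by
  have h : 0 ≤ (v - w) ⬝ᵥ (v - w) := by
    simpa using dotProduct_star_self_nonneg (v - w)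
  simp only [sub_dotProduct, dotProduct_sub] at h
  rw [dotProduct_comm w v] at h
  linarith

theorem dotProduct_self_mulVec_le_of_contraction [DecidableEq α] {F : Matrix α α ℝ}
    (hF : (1 - Fᵀ * F).PosSemidef) (v : α → ℝ) :
    (F *ᵥ v) ⬝ᵥ (F *ᵥ v) ≤ v ⬝ᵥ v := by
  have h := hF.dotProduct_mulVec_nonneg v
  simp only [star_trivial, sub_mulVec, one_mulVec, dotProduct_sub, ← mulVec_mulVec,
    Matrix.dotProduct_transpose_mulVec_eq] at h
  linarith

theorem dotProduct_self_transpose_mulVec_le_of_contraction [DecidableEq α] {F : Matrix α α ℝ}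
    (hF : (1 - Fᵀ * F).PosSemidef) (v : α → ℝ) :
    (Fᵀ *ᵥ v) ⬝ᵥ (Fᵀ *ᵥ v) ≤ v ⬝ᵥ v := by
  have h1 := dotProduct_self_mulVec_le_of_contraction hF (Fᵀ *ᵥ v)
  have h2 := two_mul_dotProduct_le (F *ᵥ Fᵀ *ᵥ v) v
  rw [← Matrix.dotProduct_transpose_mulVec_eq] at h2
  linarith

end MatrixForms

/-! ### Quadratic forms of the matrix inequalities -/

namespace UncertainPlant

variable {σ ι δ κ ζ : Type*} [Fintype σ] [DecidableEq σ] [Fintype ι] [Fintype δ] [DecidableEq δ]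
  [Fintype κ] [Fintype ζ] [DecidableEq ζ]
  {G : UncertainPlant σ ι δ κ ζ} {η ε₁ ε₂ ε₃ : ℝ} {X Y Ah : Matrix σ σ ℝ}
  {Bh : Matrix σ κ ℝ} {Ch : Matrix ι σ ℝ}

omit [Fintype δ] [Fintype ζ] in
theorem LMIFeasible.transpose_eq (h : G.LMIFeasible η ε₁ ε₂ ε₃ X Y Ah Bh Ch) :
    Xᵀ = X ∧ Yᵀ = Y := by
  have := isHermitian_fromBlocks_iff.1 h.1.isHermitian
  exact ⟨this.1.transpose_eq_self, this.2.2.2.transpose_eq_self⟩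

/-- The second matrix inequality as the negativity of a quadratic form in the block vector
`(v₁, v₂, d, z, w₁, …, w₅)`. -/
theorem LMIFeasible.form_neg (h : G.LMIFeasible η ε₁ ε₂ ε₃ X Y Ah Bh Ch)
    (v₁ v₂ : σ → ℝ) (d : δ → ℝ) (z : ζ → ℝ) (w₁ w₂ w₃ w₄ w₅ : σ → ℝ)
    (hne : Sum.elim (Sum.elim (Sum.elim v₁ v₂) (Sum.elim d z))
      (Sum.elim w₁ (Sum.elim w₂ (Sum.elim w₃ (Sum.elim w₄ w₅)))) ≠ 0) :
    2 * (v₁ ⬝ᵥ (G.AN *ᵥ X *ᵥ v₁)) + 2 * (v₁ ⬝ᵥ (G.B *ᵥ Ch *ᵥ v₁))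
      + (ε₁ + ε₂) * ((G.Lᵀ *ᵥ v₁) ⬝ᵥ (G.Lᵀ *ᵥ v₁))
      + 2 * (v₁ ⬝ᵥ (G.AN *ᵥ v₂)) + 2 * (v₂ ⬝ᵥ (Ah *ᵥ v₁))
      + 2 * ((Y *ᵥ v₂) ⬝ᵥ (G.AN *ᵥ v₂)) + 2 * (v₂ ⬝ᵥ (Bh *ᵥ G.C *ᵥ v₂))
      + ε₃ * ((G.R *ᵥ v₂) ⬝ᵥ (G.R *ᵥ v₂))
      + 2 * (v₁ ⬝ᵥ (G.Bd *ᵥ d)) + 2 * ((Y *ᵥ v₂) ⬝ᵥ (G.Bd *ᵥ d))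
      + 2 * ((G.Cz *ᵥ X *ᵥ v₁ + G.Cz *ᵥ v₂ + G.Dz *ᵥ Ch *ᵥ v₁) ⬝ᵥ z)
      - η * (d ⬝ᵥ d) - z ⬝ᵥ z
      + 2 * ((G.R *ᵥ X *ᵥ v₁) ⬝ᵥ (w₁ + w₅)) + 2 * ((G.R *ᵥ v₂) ⬝ᵥ w₂)
      + 2 * ((G.Lᵀ *ᵥ Y *ᵥ v₂) ⬝ᵥ (w₃ + w₄))
      - ε₁ * (w₁ ⬝ᵥ w₁) - ε₂ * (w₂ ⬝ᵥ w₂) - ε₃ * (w₃ ⬝ᵥ w₃) - w₄ ⬝ᵥ w₄ - w₅ ⬝ᵥ w₅ < 0 := by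
  obtain ⟨hX, hY⟩ := h.transpose_eq
  have hq := h.2.dotProduct_mulVec_pos hne
  have hdiag : ∀ (c : ℝ) (w : σ → ℝ), diagonal (fun _ => c) *ᵥ w = c • w := by
    intro c w; ext i; simp [mulVec_diagonal]
  simp only [Gamma11, Gamma12, Gamma22, star_trivial, neg_mulVec, fromBlocks_mulVec,
    transpose_add, transpose_transpose, transpose_mul,
    fromRows_mulVec, fromCols_mulVec, fromBlocks_transpose, transpose_fromRows, transpose_fromCols,
    Sum.elim_comp_inl, Sum.elim_comp_inr, sumElim_dotProduct_sumElim, dotProduct_neg,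
    dotProduct_add, transpose_zero, zero_mulVec, dotProduct_zero, add_zero, zero_add,
    ← fromBlocks_diagonal, hdiag, Sum.elim_add_add, add_mulVec, ← mulVec_mulVec, smul_mulVec,
    dotProduct_smul, smul_eq_mul, one_mulVec, hX, hY, one_smul,
    dotProduct_mulVec_left_of_transpose_eq hX, dotProduct_mulVec_left_of_transpose_eq hY,
    Matrix.dotProduct_transpose_mulVec_eq] at hq
  have hL : ∀ v w : σ → ℝ, v ⬝ᵥ (G.L *ᵥ w) = (G.Lᵀ *ᵥ v) ⬝ᵥ w := fun v w => by
    rw [← Matrix.dotProduct_transpose_mulVec_eq, transpose_transpose]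
  have hYc : ∀ u : σ → ℝ, (Y *ᵥ u) ⬝ᵥ v₂ = (Y *ᵥ v₂) ⬝ᵥ u := fun u => by
    rw [← dotProduct_mulVec_left_of_transpose_eq hY, dotProduct_comm]
  simp only [hYc, hL, dotProduct_comm _ v₁, dotProduct_comm z, dotProduct_comm _ v₂,
    dotProduct_comm w₁ (G.R *ᵥ _), dotProduct_comm w₂ (G.R *ᵥ _),
    dotProduct_comm w₅ (G.R *ᵥ _)] at hq
  simp only [dotProduct_add, dotProduct_comm _ z] at hq ⊢
  linarith

/-- The multipliers are positive because `-ε₁ I`, `-ε₂ I`, `-ε₃ I` are diagonal blocks of a negative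
definite matrix; for an empty state space these blocks are empty and give no information. -/
theorem LMIFeasible.multipliers_pos (h : G.LMIFeasible η ε₁ ε₂ ε₃ X Y Ah Bh Ch) [Nonempty σ] :
    0 < ε₁ ∧ 0 < ε₂ ∧ 0 < ε₃ := by
  have h0 : ((fun _ : σ => (1 : ℝ)) ⬝ᵥ fun _ => 1) = Fintype.card σ := by simp [dotProduct]
  have hn : (0 : ℝ) < Fintype.card σ := by exact_mod_cast Fintype.card_pos
  obtain ⟨i⟩ := ‹Nonempty σ›
  refine ⟨?_, ?_, ?_⟩
  · have := h.form_neg 0 0 0 0 (fun _ => 1) 0 0 0 0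
      (fun e => by simpa using congrFun e (Sum.inr (Sum.inl i)))
    simp only [mulVec_zero, dotProduct_zero, zero_dotProduct, mul_zero, add_zero, sub_zero, h0,
      zero_sub] at this
    exact pos_of_mul_pos_left (by linarith) hn.le
  · have := h.form_neg 0 0 0 0 0 (fun _ => 1) 0 0 0
      (fun e => by simpa using congrFun e (Sum.inr (Sum.inr (Sum.inl i))))
    simp only [mulVec_zero, dotProduct_zero, zero_dotProduct, mul_zero, add_zero, sub_zero, h0,
      zero_sub] at this
    exact pos_of_mul_pos_left (by linarith) hn.le
  · have := h.form_neg 0 0 0 0 0 0 (fun _ => 1) 0 0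
      (fun e => by simpa using congrFun e (Sum.inr (Sum.inr (Sum.inr (Sum.inl i)))))
    simp only [mulVec_zero, dotProduct_zero, zero_dotProduct, mul_zero, add_zero, sub_zero, h0,
      zero_sub] at this
    exact pos_of_mul_pos_left (by linarith) hn.le

/-- The dissipation inequality of the closed loop, for the true system matrix `A_N + L F R`, in the
coordinates `(v₁, v₂)` in which the closed-loop state is `(X v₁ + v₂, Mᵀ v₁)`. -/
theorem LMIFeasible.closed_form_neg (h : G.LMIFeasible η ε₁ ε₂ ε₃ X Y Ah Bh Ch)
    {F : Matrix σ σ ℝ} (hF : (1 - Fᵀ * F).PosSemidef)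
    (v₁ v₂ : σ → ℝ) (d : δ → ℝ) (hne : v₁ ≠ 0 ∨ v₂ ≠ 0 ∨ d ≠ 0) :
    2 * ((v₁ + Y *ᵥ v₂) ⬝ᵥ
        (G.A F *ᵥ (X *ᵥ v₁ + v₂) + G.B *ᵥ Ch *ᵥ v₁ + G.Bd *ᵥ d))
      + 2 * (v₂ ⬝ᵥ (Bh *ᵥ G.C *ᵥ (X *ᵥ v₁ + v₂)
          + (Ah - Bh * G.C * X - Y * G.B * Ch - Y * G.AN * X) *ᵥ v₁))
      + (G.Cz *ᵥ (X *ᵥ v₁ + v₂) + G.Dz *ᵥ Ch *ᵥ v₁) ⬝ᵥ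
          (G.Cz *ᵥ (X *ᵥ v₁ + v₂) + G.Dz *ᵥ Ch *ᵥ v₁)
      - η * (d ⬝ᵥ d) < 0 := by
  obtain ⟨hX, hY⟩ := h.transpose_eq
  set p := G.Lᵀ *ᵥ v₁ with hp
  set q := G.Lᵀ *ᵥ Y *ᵥ v₂ with hq
  set r := G.R *ᵥ X *ᵥ v₁ with hr
  set s := G.R *ᵥ v₂ with hs
  set z := G.Cz *ᵥ (X *ᵥ v₁ + v₂) + G.Dz *ᵥ Ch *ᵥ v₁ with hz
  -- `w₁`, `w₂`, `w₃` turn the multiplier terms into the cross terms with `F`, up to a nonnegative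
  -- remainder; `w₄`, `w₅`, `z` are the exact maximizers of the form
  have hlmi := h.form_neg v₁ v₂ d z (Fᵀ *ᵥ p) (Fᵀ *ᵥ p) (F *ᵥ s) q r (by
    intro e
    have e1 : v₁ = 0 := funext fun i => congrFun e (Sum.inl (Sum.inl (Sum.inl i)))
    have e2 : v₂ = 0 := funext fun i => congrFun e (Sum.inl (Sum.inl (Sum.inr i)))
    have e3 : d = 0 := funext fun i => congrFun e (Sum.inl (Sum.inr (Sum.inl i)))
    simp [e1, e2, e3] at hne)
  have hz' : G.Cz *ᵥ X *ᵥ v₁ + G.Cz *ᵥ v₂ + G.Dz *ᵥ Ch *ᵥ v₁ = z := by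
    rw [hz, mulVec_add]
  rw [hz'] at hlmi
  simp only [← hp, ← hq, ← hr, ← hs] at hlmi
  have hpF : 0 ≤ ε₁ * (p ⬝ᵥ p - (Fᵀ *ᵥ p) ⬝ᵥ (Fᵀ *ᵥ p)) ∧
      0 ≤ ε₂ * (p ⬝ᵥ p - (Fᵀ *ᵥ p) ⬝ᵥ (Fᵀ *ᵥ p)) ∧
      0 ≤ ε₃ * (s ⬝ᵥ s - (F *ᵥ s) ⬝ᵥ (F *ᵥ s)) := by
    have h1 := sub_nonneg.2 (dotProduct_self_transpose_mulVec_le_of_contraction hF p)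
    have h2 := sub_nonneg.2 (dotProduct_self_mulVec_le_of_contraction hF s)
    cases isEmpty_or_nonempty σ
    · simp [dotProduct]
    · obtain ⟨h₁, h₂, h₃⟩ := h.multipliers_pos
      exact ⟨mul_nonneg h₁.le h1, mul_nonneg h₂.le h1, mul_nonneg h₃.le h2⟩
  have hqr : 2 * (q ⬝ᵥ (F *ᵥ r)) ≤ q ⬝ᵥ q + r ⬝ᵥ r :=
    (two_mul_dotProduct_le _ _).trans
      (add_le_add_right (dotProduct_self_mulVec_le_of_contraction hF r) _)
  have hLt : ∀ v w : σ → ℝ, v ⬝ᵥ (G.L *ᵥ w) = (G.Lᵀ *ᵥ v) ⬝ᵥ w := fun v w => by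
    rw [← Matrix.dotProduct_transpose_mulVec_eq, transpose_transpose]
  have hFt : ∀ v w : σ → ℝ, v ⬝ᵥ (F *ᵥ w) = (Fᵀ *ᵥ v) ⬝ᵥ w := fun v w => by
    rw [← Matrix.dotProduct_transpose_mulVec_eq, transpose_transpose]
  have e1 : p ⬝ᵥ (F *ᵥ r) = r ⬝ᵥ (Fᵀ *ᵥ p) := by rw [hFt, dotProduct_comm]
  have e2 : p ⬝ᵥ (F *ᵥ s) = s ⬝ᵥ (Fᵀ *ᵥ p) := by rw [hFt, dotProduct_comm]
  simp only [A, mulVec_add, add_mulVec, sub_mulVec, ← mulVec_mulVec, dotProduct_add,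
    add_dotProduct, dotProduct_sub, hLt (v₁), hLt (Y *ᵥ v₂), ← hp, ← hq, ← hr, ← hs,
    dotProduct_mulVec_left_of_transpose_eq hY v₂] at hlmi ⊢
  linarith

omit [Fintype δ] [Fintype ζ] in
/-- If `Y X v = v`, the form of `[X I; I Y]` vanishes at `(v, -X v)`. -/
theorem LMIFeasible.isUnit_det_one_sub_mul (h : G.LMIFeasible η ε₁ ε₂ ε₃ X Y Ah Bh Ch) :
    IsUnit (1 - Y * X).det := by
  obtain ⟨hX, hY⟩ := h.transpose_eq
  by_contra hdet
  rw [isUnit_iff_ne_zero, not_not] at hdet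
  obtain ⟨v, hv, hv0⟩ := exists_mulVec_eq_zero_iff.2 hdet
  have hv' : Y *ᵥ X *ᵥ v = v := by
    rw [sub_mulVec, one_mulVec, ← mulVec_mulVec, sub_eq_zero] at hv0
    exact hv0.symm
  have := h.1.dotProduct_mulVec_pos (x := Sum.elim v (-(X *ᵥ v)))
    (fun e => hv (funext fun i => congrFun e (Sum.inl i)))
  simp only [star_trivial, fromBlocks_mulVec, Sum.elim_comp_inl, Sum.elim_comp_inr,
    sumElim_dotProduct_sumElim, one_mulVec, mulVec_neg, hv', add_neg_cancel,
    dotProduct_zero, add_zero] at this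
  exact lt_irrefl _ this

end UncertainPlant

/-! ### Bounded real certificates -/

section BoundedReal

variable {α δ ζ : Type*} [Fintype α] [Fintype δ] [Fintype ζ]

/-- `P` is a strict bounded real certificate with squared gain `η` for `x' = A x + B d`, `z = C x`:
the storage function `V(x) = xᵀ P x` is positive definite and
`V'(x) (A x + B d) + |C x|² - η |d|²` is negative definite in `(x, d)`. -/
structure IsBoundedRealCertificate (A : Matrix α α ℝ) (B : Matrix α δ ℝ) (C : Matrix ζ α ℝ)
    (η : ℝ) (P : Matrix α α ℝ) : Prop where
  posDef : P.PosDef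
  form_neg : ∀ (x : α → ℝ) (d : δ → ℝ), (x ≠ 0 ∨ d ≠ 0) →
    2 * ((P *ᵥ x) ⬝ᵥ (A *ᵥ x + B *ᵥ d)) + (C *ᵥ x) ⬝ᵥ (C *ᵥ x) - η * (d ⬝ᵥ d) < 0

namespace IsBoundedRealCertificate

variable {A : Matrix α α ℝ} {B : Matrix α δ ℝ} {C : Matrix ζ α ℝ} {η : ℝ} {P : Matrix α α ℝ}

theorem gain_pos [Nonempty δ] (h : IsBoundedRealCertificate A B C η P) : 0 < η := by
  have h1 := h.form_neg 0 (fun _ => 1) (Or.inr fun e => by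
    simpa using congrFun e (Classical.arbitrary δ))
  have hn : (0 : ℝ) < Fintype.card δ := by exact_mod_cast Fintype.card_pos
  have h0 : ((fun _ : δ => (1 : ℝ)) ⬝ᵥ fun _ => 1) = Fintype.card δ := by simp [dotProduct]
  simp only [mulVec_zero, zero_dotProduct, mul_zero, zero_add, h0] at h1
  exact pos_of_mul_pos_left (by linarith) hn.le

/-- A strict certificate leaves room for a smaller gain, since a quadratic form that is negative off
the origin is bounded away from zero on the unit sphere. -/
theorem exists_margin [Nonempty δ] (h : IsBoundedRealCertificate A B C η P) :
    ∃ η' < η, 0 ≤ η' ∧ ∀ (x : α → ℝ) (d : δ → ℝ),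
      2 * ((P *ᵥ x) ⬝ᵥ (A *ᵥ x + B *ᵥ d)) + (C *ᵥ x) ⬝ᵥ (C *ᵥ x) ≤ η' * (d ⬝ᵥ d) := by
  let q : (α → ℝ) × (δ → ℝ) → ℝ := fun v =>
    2 * ((P *ᵥ v.1) ⬝ᵥ (A *ᵥ v.1 + B *ᵥ v.2)) + (C *ᵥ v.1) ⬝ᵥ (C *ᵥ v.1) - η * (v.2 ⬝ᵥ v.2)
  have hq : Continuous q := by
    simp only [q, dotProduct, mulVec, Pi.add_apply]
    fun_prop
  have hg : Continuous fun v : (α → ℝ) × (δ → ℝ) => v.2 ⬝ᵥ v.2 := by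
    simp only [dotProduct]
    fun_prop
  have hsm : ∀ (t : ℝ) v, q (t • v) = t ^ 2 * q v := by
    intro t v
    simp only [q, Prod.smul_fst, Prod.smul_snd, mulVec_smul, ← smul_add, smul_dotProduct,
      dotProduct_smul, smul_eq_mul]
    ring
  have hneg : ∀ v, v ≠ 0 → q v < 0 := fun v hv => h.form_neg v.1 v.2 (by
    by_contra! hc
    exact hv (Prod.ext hc.1 hc.2))
  have hηpos := h.gain_pos
  have hnn : ∀ w : δ → ℝ, 0 ≤ w ⬝ᵥ w := fun w => by simpa using dotProduct_star_self_nonneg w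
  obtain ⟨c, hc, hcs⟩ : ∃ c > 0, ∀ v ∈ Metric.sphere (0 : (α → ℝ) × (δ → ℝ)) 1,
      q v + c * (v.2 ⬝ᵥ v.2) ≤ 0 := by
    obtain ⟨v₀, hv₀, hmax⟩ := (isCompact_sphere (0 : (α → ℝ) × (δ → ℝ)) 1).exists_isMaxOn
      (NormedSpace.sphere_nonempty.2 zero_le_one) hq.continuousOn
    obtain ⟨b, hb⟩ := (isCompact_sphere (0 : (α → ℝ) × (δ → ℝ)) 1).exists_bound_of_continuousOn
      hg.continuousOn
    have hm : q v₀ < 0 := hneg v₀ (ne_zero_of_mem_unit_sphere ⟨v₀, hv₀⟩)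
    have hb0 : 0 ≤ b := (norm_nonneg _).trans (hb v₀ hv₀)
    refine ⟨-q v₀ / (b + 1), div_pos (by linarith) (by linarith), fun v hv => ?_⟩
    have h1 : q v ≤ q v₀ := hmax hv
    have h2 : v.2 ⬝ᵥ v.2 ≤ b := (le_abs_self _).trans (hb v hv)
    have h3 : -q v₀ / (b + 1) * (v.2 ⬝ᵥ v.2) ≤ -q v₀ / (b + 1) * (b + 1) :=
      mul_le_mul_of_nonneg_left (by linarith) (div_nonneg (by linarith) (by linarith))
    rw [div_mul_cancel₀ _ (by linarith)] at h3
    linarith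
  refine ⟨max (η - c) 0, max_lt (by linarith) hηpos, le_max_right _ _, fun x d => ?_⟩
  have key : q (x, d) + c * (d ⬝ᵥ d) ≤ 0 := by
    by_cases hv : (x, d) = 0
    · obtain ⟨rfl, rfl⟩ := Prod.mk_eq_zero.1 hv
      simp [q]
    · have h1 := hcs (‖(x, d)‖⁻¹ • (x, d)) (by
        rw [mem_sphere_zero_iff_norm, norm_smul, norm_inv, norm_norm,
          inv_mul_cancel₀ (norm_ne_zero_iff.2 hv)])
      have hpos : 0 < ‖(x, d)‖ := norm_pos_iff.2 hv
      rw [hsm] at h1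
      simp only [Prod.smul_mk, smul_dotProduct, dotProduct_smul, smul_eq_mul] at h1
      have h2 : (‖(x, d)‖⁻¹) ^ 2 * (q (x, d) + c * (d ⬝ᵥ d)) ≤ 0 := by linarith
      exact nonpos_of_mul_nonpos_right h2 (by positivity)
  have h4 := mul_le_mul_of_nonneg_right (le_max_left (η - c) 0) (hnn d)
  simp only [q] at key
  linarith

end IsBoundedRealCertificate

end BoundedReal

/-! ### The certificate of the closed loop -/

namespace UncertainPlant

variable {σ ι δ κ ζ : Type*} [Fintype σ] [DecidableEq σ] [Fintype ι] [Fintype δ] [DecidableEq δ]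
  [Fintype κ] [Fintype ζ] [DecidableEq ζ]
  {G : UncertainPlant σ ι δ κ ζ} {η ε₁ ε₂ ε₃ : ℝ} {X Y Ah : Matrix σ σ ℝ}
  {Bh : Matrix σ κ ℝ} {Ch : Matrix ι σ ℝ}

/-- The certificate is `P = Θ Φ⁻¹`, written as the congruence `Φ⁻ᵀ [X I; I Y] Φ⁻¹`, from which
symmetry and positive definiteness can be read off. -/
theorem LMIFeasible.exists_isBoundedRealCertificate
    (h : G.LMIFeasible η ε₁ ε₂ ε₃ X Y Ah Bh Ch) {M N : Matrix σ σ ℝ}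
    (hM : IsUnit M.det) (hN : IsUnit N.det) (hNM : N * Mᵀ = 1 - Y * X)
    {F : Matrix σ σ ℝ} (hF : (1 - Fᵀ * F).PosSemidef) :
    ∃ P, IsBoundedRealCertificate (G.closedA F (G.recoveredController X Y Ah Bh Ch M N)) G.closedB
      (G.closedC (G.recoveredController X Y Ah Bh Ch M N)) η P := by
  obtain ⟨hX, hY⟩ := h.transpose_eq
  have hMt : IsUnit Mᵀ.det := by rwa [det_transpose]
  have hMN : M * Nᵀ = 1 - X * Y := by
    simpa [hX, hY] using congrArg transpose hNM
  let Φ : Matrix (σ ⊕ σ) (σ ⊕ σ) ℝ := fromBlocks X 1 Mᵀ 0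
  let Θ : Matrix (σ ⊕ σ) (σ ⊕ σ) ℝ := fromBlocks 1 Y 0 Nᵀ
  -- the inverse of `Φ`
  let T : Matrix (σ ⊕ σ) (σ ⊕ σ) ℝ := fromBlocks 0 (Mᵀ)⁻¹ 1 (-(X * (Mᵀ)⁻¹))
  let S : Matrix (σ ⊕ σ) (σ ⊕ σ) ℝ := fromBlocks X 1 1 Y
  have hΦT : Φ * T = 1 := by
    simp [Φ, T, fromBlocks_multiply, mul_nonsing_inv _ hMt]
  have hTΦ : T * Φ = 1 := mul_eq_one_comm.1 hΦT
  have hS : S = Φᵀ * Θ := by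
    simp [S, Φ, Θ, fromBlocks_transpose, fromBlocks_multiply, hX, hMN]
  have hPΦ : (Tᵀ * S * T) * Φ = Θ := by
    rw [mul_assoc, hTΦ, mul_one, hS, ← mul_assoc, ← transpose_mul, hΦT, transpose_one, one_mul]
  refine ⟨Tᵀ * S * T, ?_, ?_⟩
  · rw [← conjTranspose_eq_transpose_of_trivial]
    refine h.1.conjTranspose_mul_mul_same fun v w hvw => ?_
    simpa [hΦT] using congrArg (Φ *ᵥ ·) hvw
  intro x d hne
  obtain ⟨v₁, v₂, rfl⟩ : ∃ v₁ v₂, x = Φ *ᵥ Sum.elim v₁ v₂ :=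
    ⟨(T *ᵥ x) ∘ Sum.inl, (T *ᵥ x) ∘ Sum.inr, by simp [hΦT]⟩
  have hne' : v₁ ≠ 0 ∨ v₂ ≠ 0 ∨ d ≠ 0 := by
    by_contra! hc
    obtain ⟨rfl, rfl, rfl⟩ := hc
    have : (Sum.elim 0 0 : σ ⊕ σ → ℝ) = 0 := by ext i; cases i <;> rfl
    simp [this] at hne
  have key := h.closed_form_neg hF v₁ v₂ d hne'
  rw [mulVec_mulVec, hPΦ]
  have hNt : ∀ u w : σ → ℝ, (Nᵀ *ᵥ u) ⬝ᵥ w = u ⬝ᵥ (N *ᵥ w) := fun u w => by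
    rw [← Matrix.dotProduct_transpose_mulVec_eq, transpose_transpose]
  have hB : N * (G.recoveredController X Y Ah Bh Ch M N).Bk = Bh := by
    simp [recoveredController, mul_nonsing_inv_cancel_left _ _ hN]
  have hC : (G.recoveredController X Y Ah Bh Ch M N).Ck * Mᵀ = Ch := by
    simp [recoveredController, nonsing_inv_mul_cancel_right _ _ hMt]
  have hA : N * (G.recoveredController X Y Ah Bh Ch M N).Ak * Mᵀ
      = Ah - Bh * G.C * X - Y * G.B * Ch - Y * G.AN * X := by
    simp [recoveredController, mul_nonsing_inv_cancel_left _ _ hN,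
      nonsing_inv_mul_cancel_right _ _ hMt, mul_assoc]
    rw [Matrix.mul_assoc, Matrix.mul_assoc Ch, nonsing_inv_mul _ hMt, Matrix.mul_one]
  generalize G.recoveredController X Y Ah Bh Ch M N = K at hA hB hC ⊢
  rw [← hA, ← hB, ← hC] at key
  simp only [Φ, Θ, closedA, closedB, closedC, fromBlocks_mulVec, fromRows_mulVec, fromCols_mulVec,
    Sum.elim_comp_inl, Sum.elim_comp_inr, sumElim_dotProduct_sumElim, one_mulVec, zero_mulVec,
    mulVec_zero, dotProduct_zero, add_zero, zero_add, Sum.elim_add_add, hNt, mulVec_add,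
    ← mulVec_mulVec, dotProduct_add, add_dotProduct] at key ⊢
  linarith

end UncertainPlant

/-! ### Integrating the dissipation inequality along trajectories -/

section Response

/-- Integration by parts for two Lebesgue primitives vanishing at `0`. -/
theorem integral_primitive_mul_primitive {u v : ℝ → ℝ} {T : ℝ}
    (hu : IntervalIntegrable u volume 0 T) (hv : IntervalIntegrable v volume 0 T) :
    ∫ t in (0 : ℝ)..T, (u t * (∫ s in (0 : ℝ)..t, v s) + (∫ s in (0 : ℝ)..t, u s) * v t)
      = (∫ s in (0 : ℝ)..T, u s) * ∫ s in (0 : ℝ)..T, v s := by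
  have h0 : (0 : ℝ) ∈ Set.uIcc 0 T := Set.left_mem_uIcc
  have h := AbsolutelyContinuousOnInterval.integral_deriv_mul_eq_sub
    (hu.absolutelyContinuousOnInterval_intervalIntegral h0)
    (hv.absolutelyContinuousOnInterval_intervalIntegral h0)
  simp only [intervalIntegral.integral_same, mul_zero, sub_zero] at h
  rw [← h]
  apply intervalIntegral.integral_congr_ae
  filter_upwards [hu.ae_hasDerivAt_integral, hv.ae_hasDerivAt_integral] with t h1 h2 ht
  have ht' := Set.uIoc_subset_uIcc ht
  rw [(h1 ht' 0 h0).deriv, (h2 ht' 0 h0).deriv]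

variable {α δ ζ : Type*} [Fintype α] [Fintype δ] [Fintype ζ]

/-- The fundamental theorem of calculus for `t ↦ x(t)ᵀ P x(t)`, where `x` is the primitive of a merely
integrable function, as for Caratheodory solutions. -/
theorem integral_quadraticForm_primitive {P : Matrix α α ℝ} (hP : Pᵀ = P) {g x : ℝ → α → ℝ}
    {T : ℝ} (hT : 0 ≤ T) (hg : IntervalIntegrable g volume 0 T)
    (hx : ∀ t ∈ Set.Icc 0 T, x t = ∫ s in (0 : ℝ)..t, g s) :
    IntervalIntegrable (fun t => 2 * ((P *ᵥ x t) ⬝ᵥ g t)) volume 0 T ∧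
    ∫ t in (0 : ℝ)..T, 2 * ((P *ᵥ x t) ⬝ᵥ g t) = (P *ᵥ x T) ⬝ᵥ x T := by
  have hgi : ∀ i, IntervalIntegrable (fun s => g s i) volume 0 T := fun i =>
    ⟨(ContinuousLinearMap.proj (R := ℝ) (φ := fun _ : α => ℝ) i).integrable_comp hg.1,
      (ContinuousLinearMap.proj (R := ℝ) (φ := fun _ : α => ℝ) i).integrable_comp hg.2⟩
  have hxi : ∀ t ∈ Set.Icc 0 T, ∀ i, x t i = ∫ s in (0 : ℝ)..t, g s i := fun t ht i => by
    have hgt : IntervalIntegrable g volume 0 t :=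
      hg.mono_set (by
        rw [Set.uIcc_of_le hT, Set.uIcc_of_le ht.1]
        exact Set.Icc_subset_Icc_right ht.2)
    rw [hx t ht]
    exact ((ContinuousLinearMap.proj (R := ℝ) (φ := fun _ : α => ℝ)
      i).intervalIntegral_comp_comm hgt).symm
  have hcont : ∀ i, ContinuousOn (fun t => ∫ s in (0 : ℝ)..t, g s i) (Set.uIcc 0 T) := fun i =>
    ((hgi i).absolutelyContinuousOnInterval_intervalIntegral Set.left_mem_uIcc).continuousOn
  have hsum : Set.EqOn (fun t => 2 * ((P *ᵥ x t) ⬝ᵥ g t))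
      (fun t => ∑ i, ∑ j, P i j * (g t i * (∫ s in (0 : ℝ)..t, g s j)
        + (∫ s in (0 : ℝ)..t, g s i) * g t j)) (Set.uIcc 0 T) := by
    intro t ht
    rw [Set.uIcc_of_le hT] at ht
    simp only [← hxi t ht]
    -- the symmetry of `P` allows splitting `2 (P x)ᵀ g` into the two terms of the product rule
    have h1 : (P *ᵥ x t) ⬝ᵥ g t = ∑ i, ∑ j, P i j * (g t i * x t j) := by
      simp only [dotProduct, mulVec, Finset.sum_mul]
      exact Finset.sum_congr rfl fun i _ => Finset.sum_congr rfl fun j _ => by ring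
    have h2 : (P *ᵥ x t) ⬝ᵥ g t = ∑ i, ∑ j, P i j * (x t i * g t j) := by
      rw [h1, Finset.sum_comm]
      refine Finset.sum_congr rfl fun i _ => Finset.sum_congr rfl fun j _ => ?_
      rw [← congrFun (congrFun hP i) j, transpose_apply]
      ring
    simp only [mul_add, Finset.sum_add_distrib, ← h1, ← h2]
    ring
  have hint : ∀ i j, IntervalIntegrable (fun t => P i j * (g t i * (∫ s in (0 : ℝ)..t, g s j)
        + (∫ s in (0 : ℝ)..t, g s i) * g t j)) volume 0 T := fun i j =>
    (((hgi i).mul_continuousOn (hcont j)).add ((hgi j).continuousOn_mul (hcont i))).const_mul _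
  have hint' : ∀ i, IntervalIntegrable (fun t => ∑ j, P i j * (g t i * (∫ s in (0 : ℝ)..t, g s j)
        + (∫ s in (0 : ℝ)..t, g s i) * g t j)) volume 0 T := fun i => by
    simpa only [Finset.sum_fn] using IntervalIntegrable.sum Finset.univ fun j _ => hint i j
  constructor
  · refine IntervalIntegrable.congr (hsum.symm.mono Set.uIoc_subset_uIcc) ?_
    simpa only [Finset.sum_fn] using IntervalIntegrable.sum Finset.univ fun i _ => hint' i
  · rw [intervalIntegral.integral_congr hsum,
      intervalIntegral.integral_finsetSum fun i _ => hint' i]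
    simp only [dotProduct, mulVec, Finset.sum_mul]
    refine Finset.sum_congr rfl fun i _ => ?_
    rw [intervalIntegral.integral_finsetSum fun j _ => hint i j]
    refine Finset.sum_congr rfl fun j _ => ?_
    rw [intervalIntegral.integral_const_mul, integral_primitive_mul_primitive (hgi i) (hgi j),
      hxi T ⟨hT, le_rfl⟩, hxi T ⟨hT, le_rfl⟩]
    ring

theorem enorm_rpow_two_eq_ofReal {E : Type*} [NormedAddCommGroup E] (v : E) :
    ‖v‖ₑ ^ (2 : ℝ) = ENNReal.ofReal (‖v‖ ^ 2) := by
  rw [ENNReal.ofReal_pow (norm_nonneg _), ofReal_norm, ← ENNReal.rpow_natCast]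
  norm_num

theorem EuclideanSpace.norm_sq_eq_dotProduct (v : EuclideanSpace ℝ δ) :
    ‖v‖ ^ 2 = v.ofLp ⬝ᵥ v.ofLp := by
  rw [EuclideanSpace.real_norm_sq_eq]
  simp [dotProduct, sq]

variable {A : Matrix α α ℝ} {B : Matrix α δ ℝ} {C : Matrix ζ α ℝ} {P : Matrix α α ℝ} {η : ℝ}

theorem IsZeroStateResponse.lintegral_Ioc_le (hP : P.PosSemidef) (hη : 0 ≤ η)
    (hdis : ∀ (x : α → ℝ) (d : δ → ℝ),
      2 * ((P *ᵥ x) ⬝ᵥ (A *ᵥ x + B *ᵥ d)) + (C *ᵥ x) ⬝ᵥ (C *ᵥ x) ≤ η * (d ⬝ᵥ d))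
    {d : ℝ → EuclideanSpace ℝ δ} {z : ℝ → EuclideanSpace ℝ ζ}
    (hd : MemLp d 2 (volume.restrict (Set.Ici 0))) (hz : IsZeroStateResponse A B C d z)
    {T : ℝ} (hT : 0 ≤ T) :
    ∫⁻ t in Set.Ioc 0 T, ‖z t‖ₑ ^ (2 : ℝ)
      ≤ ENNReal.ofReal η * ∫⁻ t in Set.Ici 0, ‖d t‖ₑ ^ (2 : ℝ) := by
  obtain ⟨x, hxc, hx, hzx⟩ := hz
  have hsub : Set.Ioc 0 T ⊆ Set.Ici 0 := fun t ht => ht.1.le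
  have hdT : MemLp d 2 (volume.restrict (Set.Ioc 0 T)) := hd.mono_measure
    (Measure.restrict_mono hsub le_rfl)
  have hxT : ContinuousOn x (Set.uIcc 0 T) := hxc.mono (by
    rw [Set.uIcc_of_le hT]; exact Set.Icc_subset_Ici_self)
  have hdi : IntervalIntegrable (fun t => B *ᵥ (d t).ofLp) volume 0 T := by
    rw [intervalIntegrable_iff_integrableOn_Ioc_of_le hT]
    exact (LinearMap.toContinuousLinearMap (B.mulVecLin ∘ₗ
      (WithLp.linearEquiv 2 ℝ (δ → ℝ)).toLinearMap)).integrable_comp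
        (hdT.integrable one_le_two)
  have hg : IntervalIntegrable (fun t => A *ᵥ x t + B *ᵥ (d t).ofLp) volume 0 T :=
    ContinuousOn.intervalIntegrable (by fun_prop) |>.add hdi
  obtain ⟨hVi, hV⟩ := integral_quadraticForm_primitive (P := P)
    hP.isHermitian.transpose_eq_self
    hT hg (fun t ht => hx t ht.1)
  have hVT : 0 ≤ (P *ᵥ x T) ⬝ᵥ x T := by
    simpa [dotProduct_comm] using hP.dotProduct_mulVec_nonneg (x T)
  have hCc : ContinuousOn (fun t => (C *ᵥ x t) ⬝ᵥ (C *ᵥ x t)) (Set.uIcc 0 T) := by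
    have : Continuous fun v : α → ℝ => (C *ᵥ v) ⬝ᵥ (C *ᵥ v) := by
      simp only [dotProduct, mulVec]; fun_prop
    exact this.comp_continuousOn hxT
  have hCi := hCc.intervalIntegrable (μ := volume)
  have hDi : IntegrableOn (fun t => ‖d t‖ ^ 2) (Set.Ioc 0 T) := hdT.integrable_norm_pow two_ne_zero
  have hDi' : IntervalIntegrable (fun t => ‖d t‖ ^ 2) volume 0 T :=
    (intervalIntegrable_iff_integrableOn_Ioc_of_le hT).2 hDi
  have hmono := intervalIntegral.integral_mono_on hT (hVi.add hCi) (hDi'.const_mul η)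
    (fun t _ => by
      rw [EuclideanSpace.norm_sq_eq_dotProduct]
      exact hdis (x t) (d t).ofLp)
  rw [intervalIntegral.integral_add hVi hCi, hV, intervalIntegral.integral_const_mul] at hmono
  have hreal : ∫ t in Set.Ioc 0 T, (C *ᵥ x t) ⬝ᵥ (C *ᵥ x t) ≤ η * ∫ t in Set.Ioc 0 T, ‖d t‖ ^ 2 := by
    rw [← intervalIntegral.integral_of_le hT, ← intervalIntegral.integral_of_le hT]
    linarith
  calc ∫⁻ t in Set.Ioc 0 T, ‖z t‖ₑ ^ (2 : ℝ)
      = ∫⁻ t in Set.Ioc 0 T, ENNReal.ofReal ((C *ᵥ x t) ⬝ᵥ (C *ᵥ x t)) :=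
        setLIntegral_congr_fun measurableSet_Ioc fun t ht => by
          rw [enorm_rpow_two_eq_ofReal, EuclideanSpace.norm_sq_eq_dotProduct, hzx t ht.1.le]
    _ = ENNReal.ofReal (∫ t in Set.Ioc 0 T, (C *ᵥ x t) ⬝ᵥ (C *ᵥ x t)) :=
        (ofReal_integral_eq_lintegral_ofReal
          ((intervalIntegrable_iff_integrableOn_Ioc_of_le hT).1 hCi)
          (Filter.Eventually.of_forall fun t => by
            simpa using dotProduct_star_self_nonneg (C *ᵥ x t))).symm
    _ ≤ ENNReal.ofReal (η * ∫ t in Set.Ioc 0 T, ‖d t‖ ^ 2) := ENNReal.ofReal_le_ofReal hreal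
    _ = ENNReal.ofReal η * ∫⁻ t in Set.Ioc 0 T, ‖d t‖ₑ ^ (2 : ℝ) := by
        rw [ENNReal.ofReal_mul hη, ofReal_integral_eq_lintegral_ofReal hDi
          (Filter.Eventually.of_forall fun t => sq_nonneg _)]
        simp only [enorm_rpow_two_eq_ofReal]
    _ ≤ _ := by gcongr

theorem l2Gain_le_of_dissipative (hP : P.PosSemidef) (hη : 0 ≤ η)
    (hdis : ∀ (x : α → ℝ) (d : δ → ℝ),
      2 * ((P *ᵥ x) ⬝ᵥ (A *ᵥ x + B *ᵥ d)) + (C *ᵥ x) ⬝ᵥ (C *ᵥ x) ≤ η * (d ⬝ᵥ d)) :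
    l2Gain A B C ≤ ENNReal.ofReal √η := by
  refine iSup_le fun d => iSup_le fun z => iSup_le fun hd => iSup_le fun _ => iSup_le fun hz => ?_
  refine ENNReal.div_le_of_le_mul ?_
  have hle : ∫⁻ t in Set.Ici 0, ‖z t‖ₑ ^ (2 : ℝ)
      ≤ ENNReal.ofReal η * ∫⁻ t in Set.Ici 0, ‖d t‖ₑ ^ (2 : ℝ) := by
    have hU : Set.Ioi (0 : ℝ) = ⋃ n : ℕ, Set.Ioc (0 : ℝ) n := by
      ext t
      simp only [Set.mem_Ioi, Set.mem_iUnion, Set.mem_Ioc]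
      exact ⟨fun h => (exists_nat_ge t).imp fun n hn => ⟨h, hn⟩, fun ⟨_, h⟩ => h.1⟩
    rw [← setLIntegral_congr (Ioi_ae_eq_Ici (a := (0 : ℝ))), hU, setLIntegral_iUnion_of_directed]
    · exact iSup_le fun n => hz.lintegral_Ioc_le hP hη hdis hd n.cast_nonneg
    · exact Monotone.directed_le fun m n hmn => Set.Ioc_subset_Ioc_right (Nat.cast_le.2 hmn)
  rw [eLpNorm_eq_lintegral_rpow_enorm_toReal two_ne_zero ENNReal.ofNat_ne_top,
    eLpNorm_eq_lintegral_rpow_enorm_toReal two_ne_zero ENNReal.ofNat_ne_top, Real.sqrt_eq_rpow,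
    ← ENNReal.ofReal_rpow_of_nonneg hη (by norm_num)]
  simp only [ENNReal.toReal_ofNat]
  rw [← ENNReal.mul_rpow_of_nonneg _ _ (by norm_num)]
  gcongr

end Response

/-! ### Eigenvalues and frequency response -/

section Frequency

variable {α δ ζ : Type*} [Fintype α] [Fintype δ] [Fintype ζ]

omit [Fintype ζ] in
theorem Matrix.re_map_ofReal_mulVec (M : Matrix ζ α ℝ) (v : α → ℂ) :
    (fun i => ((M.map (Complex.ofReal : ℝ → ℂ) *ᵥ v) i).re) = M *ᵥ fun i => (v i).re := by
  ext i; simp [mulVec, dotProduct]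

omit [Fintype ζ] in
theorem Matrix.im_map_ofReal_mulVec (M : Matrix ζ α ℝ) (v : α → ℂ) :
    (fun i => ((M.map (Complex.ofReal : ℝ → ℂ) *ᵥ v) i).im) = M *ᵥ fun i => (v i).im := by
  ext i; simp [mulVec, dotProduct]

theorem EuclideanSpace.complex_norm_sq_eq (v : EuclideanSpace ℂ δ) :
    ‖v‖ ^ 2 = (fun i => (v i).re) ⬝ᵥ (fun i => (v i).re)
      + (fun i => (v i).im) ⬝ᵥ (fun i => (v i).im) := by
  rw [EuclideanSpace.norm_sq_eq]
  simp only [dotProduct, ← Finset.sum_add_distrib, Complex.sq_norm, Complex.normSq_apply]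

variable [DecidableEq α] {A : Matrix α α ℝ} {B : Matrix α δ ℝ} {C : Matrix ζ α ℝ}
  {P : Matrix α α ℝ} {η : ℝ}

/-- Lyapunov's criterion. For an eigenvector `a + i b` with eigenvalue `μ`, the sum of the form
`xᵀ P A x` over `x = a, b` is `Re μ` times a positive number. -/
theorem Matrix.isHurwitz_of_lyapunov (hP : P.PosDef)
    (hneg : ∀ x : α → ℝ, x ≠ 0 → (P *ᵥ x) ⬝ᵥ (A *ᵥ x) < 0) : A.IsHurwitz := by
  intro μ hμ
  have hPs : Pᵀ = P := hP.isHermitian.transpose_eq_self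
  rw [spectrum.mem_iff, isUnit_iff_isUnit_det, isUnit_iff_ne_zero, not_not] at hμ
  obtain ⟨v, hv, hv0⟩ := exists_mulVec_eq_zero_iff.2 hμ
  have hev : A.map (Complex.ofReal : ℝ → ℂ) *ᵥ v = μ • v := by
    rw [sub_mulVec, sub_eq_zero, Algebra.algebraMap_eq_smul_one, smul_mulVec, one_mulVec] at hv0
    exact hv0.symm
  set a : α → ℝ := fun i => (v i).re with ha
  set b : α → ℝ := fun i => (v i).im with hb
  have hAa : A *ᵥ a = μ.re • a - μ.im • b := by
    rw [ha, ← re_map_ofReal_mulVec, hev]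
    ext i; simp [hb]
  have hAb : A *ᵥ b = μ.re • b + μ.im • a := by
    rw [hb, ← im_map_ofReal_mulVec, hev]
    ext i; simp [ha]
  have hab : a ≠ 0 ∨ b ≠ 0 := by
    by_contra! hc
    exact hv (funext fun i => Complex.ext (congrFun hc.1 i) (congrFun hc.2 i))
  have hle : ∀ x : α → ℝ, (P *ᵥ x) ⬝ᵥ (A *ᵥ x) ≤ 0 := fun x => by
    by_cases hx : x = 0
    · simp [hx]
    · exact (hneg x hx).le
  have hge : ∀ x : α → ℝ, 0 ≤ (P *ᵥ x) ⬝ᵥ x := fun x => by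
    simpa [dotProduct_comm] using hP.posSemidef.dotProduct_mulVec_nonneg x
  have hsum : (P *ᵥ a) ⬝ᵥ (A *ᵥ a) + (P *ᵥ b) ⬝ᵥ (A *ᵥ b)
      = μ.re * ((P *ᵥ a) ⬝ᵥ a + (P *ᵥ b) ⬝ᵥ b) := by
    have hc : (P *ᵥ b) ⬝ᵥ a = (P *ᵥ a) ⬝ᵥ b := by
      rw [← dotProduct_mulVec_left_of_transpose_eq hPs, dotProduct_comm]
    rw [hAa, hAb]
    simp only [dotProduct_sub, dotProduct_add, dotProduct_smul, smul_eq_mul, hc]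
    ring
  have hlt : (P *ᵥ a) ⬝ᵥ (A *ᵥ a) + (P *ᵥ b) ⬝ᵥ (A *ᵥ b) < 0 := by
    rcases hab with h | h
    · linarith [hneg a h, hle b]
    · linarith [hneg b h, hle a]
  rw [hsum] at hlt
  by_contra! hμre
  exact absurd (mul_nonneg hμre (add_nonneg (hge a) (hge b))) (not_le.2 hlt)

theorem IsBoundedRealCertificate.isHurwitz (h : IsBoundedRealCertificate A B C η P) :
    A.IsHurwitz := by
  refine isHurwitz_of_lyapunov h.posDef fun x hx => ?_
  have h1 := h.form_neg x 0 (Or.inl hx)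
  have h2 : 0 ≤ (C *ᵥ x) ⬝ᵥ (C *ᵥ x) := by simpa using dotProduct_star_self_nonneg (C *ᵥ x)
  simp only [mulVec_zero, add_zero, dotProduct_zero, mul_zero, sub_zero] at h1
  linarith

/-- For the response `v = a + i b` to the input `w = p + i q` at frequency `ω`, one has
`A a + B p = -ω b` and `A b + B q = ω a`, so the storage terms of the dissipation inequalities at
`(a, p)` and `(b, q)` cancel. -/
theorem hInfNorm_le_of_dissipative [DecidableEq δ] (hA : A.IsHurwitz) (hP : Pᵀ = P) (hη : 0 ≤ η)
    (hdis : ∀ (x : α → ℝ) (d : δ → ℝ),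
      2 * ((P *ᵥ x) ⬝ᵥ (A *ᵥ x + B *ᵥ d)) + (C *ᵥ x) ⬝ᵥ (C *ᵥ x) ≤ η * (d ⬝ᵥ d)) :
    hInfNorm A B C ≤ ENNReal.ofReal √η := by
  refine iSup_le fun ω => ENNReal.ofReal_le_ofReal ?_
  rw [l2_opNorm_def]
  refine ContinuousLinearMap.opNorm_le_bound _ (Real.sqrt_nonneg _) fun w => ?_
  set S : Matrix α α ℂ := (Complex.I * (ω : ℂ)) • (1 : Matrix α α ℂ) -
    A.map (Complex.ofReal : ℝ → ℂ) with hS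
  have hSu : IsUnit S.det := by
    rw [← isUnit_iff_isUnit_det]
    by_contra hc
    have := hA (Complex.I * ω) (by
      rw [spectrum.mem_iff, Algebra.algebraMap_eq_smul_one]; exact hc)
    simp at this
  set v : α → ℂ := S⁻¹ *ᵥ B.map (Complex.ofReal : ℝ → ℂ) *ᵥ w.ofLp with hv
  have hSv : S *ᵥ v = B.map (Complex.ofReal : ℝ → ℂ) *ᵥ w.ofLp := by
    rw [hv, mulVec_mulVec, mul_nonsing_inv _ hSu, one_mulVec]
  have hres : A.map (Complex.ofReal : ℝ → ℂ) *ᵥ v + B.map (Complex.ofReal : ℝ → ℂ) *ᵥ w.ofLp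
      = (Complex.I * (ω : ℂ)) • v := by
    rw [← hSv, hS, sub_mulVec, smul_mulVec, one_mulVec, add_sub_cancel]
  have hT : ((toEuclideanLin (𝕜 := ℂ) (m := ζ) (n := δ)).trans LinearMap.toContinuousLinearMap)
      (transferFunction A B C (Complex.I * ω)) w
      = WithLp.toLp 2 (C.map (Complex.ofReal : ℝ → ℂ) *ᵥ v) := by
    change WithLp.toLp 2 (transferFunction A B C (Complex.I * ω) *ᵥ w.ofLp) = _
    rw [transferFunction, ← hS, hv, mulVec_mulVec, mulVec_mulVec, Matrix.mul_assoc]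
  rw [hT, ← Real.sqrt_sq (norm_nonneg w), ← Real.sqrt_mul hη]
  refine Real.le_sqrt_of_sq_le ?_
  rw [EuclideanSpace.complex_norm_sq_eq, EuclideanSpace.complex_norm_sq_eq]
  simp only [re_map_ofReal_mulVec, im_map_ofReal_mulVec]
  set a : α → ℝ := fun i => (v i).re with ha
  set b : α → ℝ := fun i => (v i).im with hb
  set p : δ → ℝ := fun i => (w i).re with hp
  set q : δ → ℝ := fun i => (w i).im with hq
  have h1 : A *ᵥ a + B *ᵥ p = -ω • b := by
    have := congrArg (fun u : α → ℂ => fun i => (u i).re) hres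
    rw [ha, hp, ← re_map_ofReal_mulVec, ← re_map_ofReal_mulVec]
    ext i
    simpa [hb] using congrFun this i
  have h2 : A *ᵥ b + B *ᵥ q = ω • a := by
    have := congrArg (fun u : α → ℂ => fun i => (u i).im) hres
    rw [hb, hq, ← im_map_ofReal_mulVec, ← im_map_ofReal_mulVec]
    ext i
    simpa [ha] using congrFun this i
  have hc : (P *ᵥ b) ⬝ᵥ a = (P *ᵥ a) ⬝ᵥ b := by
    rw [← dotProduct_mulVec_left_of_transpose_eq hP, dotProduct_comm]
  have k1 := hdis a p
  have k2 := hdis b q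
  rw [h1, dotProduct_smul, smul_eq_mul] at k1
  rw [h2, dotProduct_smul, smul_eq_mul, hc] at k2
  linarith

end Frequency

/-! ### The robust output-feedback theorem -/

theorem theorem3 {σ ι δ κ ζ : Type*}
    [Fintype σ] [DecidableEq σ] [Fintype ι] [Fintype δ] [DecidableEq δ] [Nonempty δ]
    [Fintype κ] [Fintype ζ] [DecidableEq ζ]
    (G : UncertainPlant σ ι δ κ ζ) (η ε₁ ε₂ ε₃ : ℝ) (X Y Ah : Matrix σ σ ℝ)
    (Bh : Matrix σ κ ℝ) (Ch : Matrix ι σ ℝ)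
    (hLMI : G.LMIFeasible η ε₁ ε₂ ε₃ X Y Ah Bh Ch) :
    (∃ M N : Matrix σ σ ℝ, IsUnit M.det ∧ IsUnit N.det ∧ N * Mᵀ = 1 - Y * X) ∧
    ∀ M N : Matrix σ σ ℝ, IsUnit M.det → IsUnit N.det → N * Mᵀ = 1 - Y * X →
      ∀ F : Matrix σ σ ℝ, (1 - Fᵀ * F).PosSemidef →
        (G.closedA F (G.recoveredController X Y Ah Bh Ch M N)).IsHurwitz ∧
        l2Gain (G.closedA F (G.recoveredController X Y Ah Bh Ch M N)) G.closedB
          (G.closedC (G.recoveredController X Y Ah Bh Ch M N)) < ENNReal.ofReal (√η) ∧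
        hInfNorm (G.closedA F (G.recoveredController X Y Ah Bh Ch M N)) G.closedB
          (G.closedC (G.recoveredController X Y Ah Bh Ch M N)) < ENNReal.ofReal (√η) := by
  -- `1 - Y X` is nonsingular, so the factorization with `M = 1` will do
  refine ⟨⟨1, 1 - Y * X, by simp, hLMI.isUnit_det_one_sub_mul, by simp⟩, ?_⟩
  intro M N hM hN hNM F hF
  obtain ⟨P, hP⟩ := hLMI.exists_isBoundedRealCertificate hM hN hNM hF
  obtain ⟨η', hlt, hη', hdis⟩ := hP.exists_margin
  have hsqrt : ENNReal.ofReal √η' < ENNReal.ofReal √η :=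
    (ENNReal.ofReal_lt_ofReal_iff (Real.sqrt_pos.2 hP.gain_pos)).2 (Real.sqrt_lt_sqrt hη' hlt)
  have hH := hP.isHurwitz
  exact ⟨hH, (l2Gain_le_of_dissipative hP.posDef.posSemidef hη' hdis).trans_lt hsqrt,
    (hInfNorm_le_of_dissipative hH hP.posDef.isHermitian.transpose_eq_self hη' hdis).trans_lt hsqrt⟩
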